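/- For every dimension $D$ there is a constant $C>0$, depending only on $D$, such that the following holds. A $C^\infty$ diffeomorphism $\Phi$ of $\mathbb R^D$ onto itself is called $\varepsilon$-distorted if $(1+\varepsilon)^{-1}I\le [(\nabla\Phi)(x)]^{T}[(\nabla\Phi)(x)]\le(1+\varepsilon)I$ as symmetric matrices for all $x\in\mathbb R^D$. Given $0<\varepsilon<C$, there exist $\eta,\delta>0$, depending only on $\varepsilon$ and $D$, such that: if $1\le k\le D$ and $y_1,\dots,y_k$ and $z_1,\dots,z_k$ are two families of $k$ distinct points of $\mathbb R^D$ with $y_1=z_1$ and $$(1+\delta)^{-1}\le\frac{|z_i-z_j|}{|y_i-y_j|}\le 1+\delta\qquad(i\ne j),$$ where $|\cdot|$ is the Euclidean norm, then there exists an $\varepsilon$-distorted diffeomorphism $\Phi:\mathbb R^D\to\mathbb R^D$ such that $\Phi(y_i)=z_i$ for $1\le i\le k$ and $\Phi(x)=x$ for all $x\in\mathbb R^D$ with $|x-y_1|\ge\eta^{-1}\,\mathrm{diam}\{y_1,\dots,y_k\}$. -/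

import Mathlib

open scoped Manifold ContDiff

/-- The Jacobian matrix `∇Φ(x)` of a map of `ℝ^D` into itself: its `(i, j)` entry is the partial
derivative of the `i`-th component of `Φ` in the direction of the `j`-th coordinate. -/
noncomputable def jacobianMatrix {D : ℕ}
    (Φ : EuclideanSpace ℝ (Fin D) → EuclideanSpace ℝ (Fin D)) (x : EuclideanSpace ℝ (Fin D)) :
    Matrix (Fin D) (Fin D) ℝ :=
  Matrix.of fun i j => (fderiv ℝ Φ x (EuclideanSpace.single j 1)) i

/-- A (smooth) diffeomorphism `Φ` of `ℝ^D` onto itself is `ε`-distorted if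
`(1 + ε)⁻¹ I ≤ ∇Φ(x)ᵀ ∇Φ(x) ≤ (1 + ε) I` for all `x`, where `A ≤ B` for symmetric matrices means
that `B - A` is positive semidefinite. -/
def IsDistorted {D : ℕ} (ε : ℝ)
    (Φ : EuclideanSpace ℝ (Fin D) ≃ₘ[ℝ] EuclideanSpace ℝ (Fin D)) : Prop :=
  ∀ x : EuclideanSpace ℝ (Fin D),
    ((jacobianMatrix Φ x).transpose * jacobianMatrix Φ x
        - (1 + ε)⁻¹ • (1 : Matrix (Fin D) (Fin D) ℝ)).PosSemidef ∧
    ((1 + ε) • (1 : Matrix (Fin D) (Fin D) ℝ)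
        - (jacobianMatrix Φ x).transpose * jacobianMatrix Φ x).PosSemidef

open Filter Topology

/-! The points are matched one at a time, by induction on their number, using diffeomorphisms that
are bi-Lipschitz together with their inverse; such maps compose well, and constant `√(1 + ε)` gives
`ε`-distortion. Suppose a map `Φ` already sends all points but the last to their targets. Then the
image `a` of the last point and its target `b` have almost the same distances to the matched targets
`p i`, fewer than `D` in number. It remains to move `a` to `b` almost isometrically while fixing
every `p i` (`exists_move`).

If the distances agree exactly (`exists_exact_move`), put `p 0` at the origin. Then `a - b` is
orthogonal to all `p i`, and `k ≤ D` leaves room for a unit vector `w` orthogonal to `a - b` and to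
all `p i`. A rotation in the plane of `a - b` and `w` fixes the `p i` and takes `a` to `b`. Its
angle is cut off near the axis and far away; a cutoff slow on the logarithmic scale costs
arbitrarily little distortion.

The approximate case follows by compactness (`exists_move_of_norm_le`): a sequence of
counterexamples converges to an exact configuration, whose rotation, followed by a small slide,
handles the late terms. -/

/-- A diffeomorphism such that it and its inverse are Lipschitz with constant `q`. -/
def IsBiLipschitz {E : Type*} [NormedAddCommGroup E] [NormedSpace ℝ E] (q : ℝ)
    (Φ : E ≃ₘ[ℝ] E) : Prop :=
  (∀ x y, ‖Φ x - Φ y‖ ≤ q * ‖x - y‖) ∧ ∀ x y, ‖Φ.symm x - Φ.symm y‖ ≤ q * ‖x - y‖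

/-! ### Composition and rescaling of bi-Lipschitz diffeomorphisms. -/

section BiLipschitz

variable {E : Type*} [NormedAddCommGroup E] [NormedSpace ℝ E]

/-- A diffeomorphism of a normed space from a pair of mutually inverse smooth maps. -/
def diffeomorphOfContDiff (f g : E → E) (hgf : Function.LeftInverse g f)
    (hfg : Function.RightInverse g f) (hf : ContDiff ℝ ∞ f) (hg : ContDiff ℝ ∞ g) :
    E ≃ₘ[ℝ] E where
  toEquiv := ⟨f, g, hgf, hfg⟩
  contMDiff_toFun := hf.contMDiff
  contMDiff_invFun := hg.contMDiff

theorem isBiLipschitz_refl {q : ℝ} (hq : 1 ≤ q) :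
    IsBiLipschitz q (Diffeomorph.refl 𝓘(ℝ, E) E ∞) :=
  ⟨fun x y => le_mul_of_one_le_left (norm_nonneg (x - y)) hq,
    fun x y => le_mul_of_one_le_left (norm_nonneg (x - y)) hq⟩

theorem IsBiLipschitz.trans {q₁ q₂ q : ℝ} {Φ Ψ : E ≃ₘ[ℝ] E} (h₁ : IsBiLipschitz q₁ Φ)
    (h₂ : IsBiLipschitz q₂ Ψ) (hq₁ : 0 ≤ q₁) (hq₂ : 0 ≤ q₂) (hq : q₁ * q₂ ≤ q) :
    IsBiLipschitz q (Φ.trans Ψ) := by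
  constructor
  · intro x y
    calc ‖Ψ (Φ x) - Ψ (Φ y)‖ ≤ q₂ * (q₁ * ‖x - y‖) :=
          (h₂.1 _ _).trans (mul_le_mul_of_nonneg_left (h₁.1 _ _) hq₂)
      _ = (q₁ * q₂) * ‖x - y‖ := by ring
      _ ≤ q * ‖x - y‖ := by gcongr
  · intro x y
    calc ‖Φ.symm (Ψ.symm x) - Φ.symm (Ψ.symm y)‖ ≤ q₁ * (q₂ * ‖x - y‖) :=
          (h₁.2 _ _).trans (mul_le_mul_of_nonneg_left (h₂.2 _ _) hq₁)
      _ = (q₁ * q₂) * ‖x - y‖ := by ring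
      _ ≤ q * ‖x - y‖ := by gcongr

/-- Conjugating a bi-Lipschitz diffeomorphism by the similarity `x ↦ (x - c) / r`. -/
theorem IsBiLipschitz.exists_conj {q : ℝ} {Φ : E ≃ₘ[ℝ] E} (h : IsBiLipschitz q Φ) (c : E)
    {r : ℝ} (hr : 0 < r) :
    ∃ Ψ : E ≃ₘ[ℝ] E, IsBiLipschitz q Ψ ∧ ∀ x, Ψ x = c + r • Φ (r⁻¹ • (x - c)) := by
  have key : ∀ f : E → E, (∀ x y, ‖f x - f y‖ ≤ q * ‖x - y‖) → ∀ x y,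
      ‖(c + r • f (r⁻¹ • (x - c))) - (c + r • f (r⁻¹ • (y - c)))‖ ≤ q * ‖x - y‖ := by
    intro f hf x y
    rw [add_sub_add_left_eq_sub, ← smul_sub, norm_smul, Real.norm_of_nonneg hr.le]
    refine (mul_le_mul_of_nonneg_left (hf _ _) hr.le).trans_eq ?_
    rw [← smul_sub, norm_smul, Real.norm_of_nonneg (inv_pos.2 hr).le, sub_sub_sub_cancel_right]
    field_simp
  have inv : ∀ f g : E → E, Function.LeftInverse g f → Function.LeftInverse
      (fun x => c + r • g (r⁻¹ • (x - c))) (fun x => c + r • f (r⁻¹ • (x - c))) := by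
    intro f g hgf x
    simp [smul_smul, hr.ne', hgf _]
  have smooth : ∀ f : E → E, ContDiff ℝ ∞ f →
      ContDiff ℝ ∞ (fun x => c + r • f (r⁻¹ • (x - c))) := by
    intro f hf
    fun_prop
  exact ⟨diffeomorphOfContDiff _ _ (inv Φ Φ.symm Φ.symm_apply_apply)
    (inv Φ.symm Φ Φ.apply_symm_apply) (smooth _ Φ.contDiff) (smooth _ Φ.symm.contDiff),
    ⟨key _ h.1, key _ h.2⟩, fun _ => rfl⟩

end BiLipschitz

/-! ### Logarithmically slow cutoffs. -/

section Cutoff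

theorem Real.smoothTransition.exists_lipschitz :
    ∃ K : ℝ, 0 < K ∧ ∀ x y, |Real.smoothTransition x - Real.smoothTransition y| ≤ K * |x - y| := by
  obtain ⟨K, hK⟩ := (Real.smoothTransition.contDiff (n := 1)).contDiffOn.exists_lipschitzOnWith
    one_ne_zero (convex_Icc (0 : ℝ) 1) isCompact_Icc
  refine ⟨K + 1, by positivity, fun x y => ?_⟩
  have h := hK.dist_le_mul _ (Set.projIcc (0 : ℝ) 1 zero_le_one x).2 _
    (Set.projIcc (0 : ℝ) 1 zero_le_one y).2
  rw [Real.smoothTransition.projIcc, Real.smoothTransition.projIcc, Real.dist_eq] at h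
  refine h.trans ?_
  have h2 : dist (Set.projIcc (0 : ℝ) 1 zero_le_one x : ℝ) (Set.projIcc (0 : ℝ) 1 zero_le_one y)
      ≤ |x - y| := by
    rw [Real.dist_eq]
    exact Set.abs_projIcc_sub_projIcc zero_le_one
  gcongr
  simp

theorem sqrt_sq_add_sub_le {r s c : ℝ} (hr : 0 ≤ r) (hrs : r ≤ s) (hc : 0 < c) :
    √(s ^ 2 + c) - √(r ^ 2 + c) ≤ s - r := by
  have h1 : r ≤ √(r ^ 2 + c) := Real.le_sqrt_of_sq_le (by linarith)
  have : √(s ^ 2 + c) ≤ √(r ^ 2 + c) + (s - r) := by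
    apply Real.sqrt_le_iff.2
    have h2 := Real.sq_sqrt (show 0 ≤ r ^ 2 + c by positivity)
    constructor
    · linarith
    · nlinarith
  linarith

/-- A cutoff function that varies slowly on the logarithmic scale. -/
theorem exists_slow_cutoff {κ : ℝ} (hκ : 0 < κ) :
    ∃ c : ℝ, 0 < c ∧ c < 1 ∧ ∃ f : ℝ → ℝ, (∀ t, 0 ≤ t → ContDiffAt ℝ ∞ f t) ∧
      (∀ t, 0 ≤ f t ∧ f t ≤ 1) ∧ (∀ t, 0 ≤ t → t ≤ c → f t = 0) ∧ (∀ t, 1 ≤ t → f t = 1) ∧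
      ∀ r s, 0 ≤ r → 0 ≤ s → min r s * |f (r ^ 2) - f (s ^ 2)| ≤ κ * |r - s| := by
  obtain ⟨K, hK, hlip⟩ := Real.smoothTransition.exists_lipschitz
  set M := K / κ with hM
  have hMpos : 0 < M := by positivity
  -- The transition runs while `t + c` goes from `2 * c` to `1`, a logarithmic length of `2 * M`.
  set c := Real.exp (-(2 * M)) / 2 with hc
  have hcpos : 0 < c := by positivity
  have hc1 : c < 1 := by
    have : Real.exp (-(2 * M)) ≤ 1 := Real.exp_le_one_iff.2 (by linarith)
    linarith
  have hlog : Real.log (2 * c) = -(2 * M) := by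
    rw [hc, mul_div_cancel₀ _ two_ne_zero, Real.log_exp]
  -- Shifting the argument of the logarithm by `c` keeps the function smooth at `t = 0`.
  refine ⟨c, hcpos, hc1, fun t => Real.smoothTransition
    ((Real.log (t + c) - Real.log (2 * c)) / (2 * M)), ?_, ?_, ?_, ?_, ?_⟩
  · intro t ht
    have h : ContDiffAt ℝ ∞ (fun t => (Real.log (t + c) - Real.log (2 * c)) / (2 * M)) t := by
      refine ContDiffAt.div_const (ContDiffAt.sub (ContDiffAt.log (by fun_prop) ?_)
        contDiffAt_const) _
      positivity
    exact Real.smoothTransition.contDiffAt.comp t h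
  · exact fun t => ⟨Real.smoothTransition.nonneg _, Real.smoothTransition.le_one _⟩
  · intro t ht htc
    apply Real.smoothTransition.zero_of_nonpos
    have := Real.log_le_log (by positivity) (show t + c ≤ 2 * c by linarith)
    exact div_nonpos_of_nonpos_of_nonneg (by linarith) (by positivity)
  · intro t ht
    apply Real.smoothTransition.one_of_one_le
    rw [hlog, le_div_iff₀ (by positivity)]
    have := Real.log_nonneg (show 1 ≤ t + c by linarith)
    linarith
  -- With `X = √(r² + c)` and `Y = √(s² + c)`, the factor `r ≤ X` absorbs the derivative `1 / X` of
  -- the logarithm, and `Y - X ≤ s - r`.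
  · have main : ∀ r s, 0 ≤ r → r ≤ s → r * |Real.smoothTransition
        ((Real.log (r ^ 2 + c) - Real.log (2 * c)) / (2 * M)) - Real.smoothTransition
        ((Real.log (s ^ 2 + c) - Real.log (2 * c)) / (2 * M))| ≤ κ * |r - s| := by
      intro r s hr hrs
      set X := √(r ^ 2 + c) with hX
      set Y := √(s ^ 2 + c) with hY
      have hXp : 0 < X := Real.sqrt_pos.2 (by positivity)
      have hXY : X ≤ Y := Real.sqrt_le_sqrt (by gcongr)
      have hYp : 0 < Y := hXp.trans_le hXY
      have hrX : r ≤ X := Real.le_sqrt_of_sq_le (by linarith)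
      have e1 : Real.log (r ^ 2 + c) = 2 * Real.log X := by
        rw [hX, Real.log_sqrt (by positivity)]; ring
      have e2 : Real.log (s ^ 2 + c) = 2 * Real.log Y := by
        rw [hY, Real.log_sqrt (by positivity)]; ring
      have hl := hlip ((Real.log (r ^ 2 + c) - Real.log (2 * c)) / (2 * M))
        ((Real.log (s ^ 2 + c) - Real.log (2 * c)) / (2 * M))
      have e3 : (Real.log (r ^ 2 + c) - Real.log (2 * c)) / (2 * M) -
          (Real.log (s ^ 2 + c) - Real.log (2 * c)) / (2 * M) =
          -((Real.log Y - Real.log X) / M) := by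
        rw [e1, e2]; field_simp; ring
      have hlogle : Real.log Y - Real.log X ≤ (Y - X) / X := by
        rw [← Real.log_div hYp.ne' hXp.ne']
        have := Real.log_le_sub_one_of_pos (div_pos hYp hXp)
        rwa [sub_div, div_self hXp.ne']
      have hlogn : 0 ≤ Real.log Y - Real.log X := sub_nonneg.2 (Real.log_le_log hXp hXY)
      rw [e3, abs_neg, abs_of_nonneg (div_nonneg hlogn hMpos.le)] at hl
      have e4 : |r - s| = s - r := by rw [abs_sub_comm, abs_of_nonneg (by linarith)]
      rw [e4]
      calc _ ≤ r * (K * ((Real.log Y - Real.log X) / M)) := by gcongr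
        _ = κ * (r * (Real.log Y - Real.log X)) := by rw [hM]; field_simp
        _ ≤ κ * (X * ((Y - X) / X)) := by gcongr
        _ = κ * (Y - X) := by field_simp
        _ ≤ κ * (s - r) := by
            have := sqrt_sq_add_sub_le hr hrs hcpos
            gcongr
    intro r s hr hs
    rcases le_total r s with h | h
    · rw [min_eq_left h]
      exact main r s hr h
    · rw [min_eq_right h, abs_sub_comm, abs_sub_comm r s]
      exact main s r hs h

end Cutoff

/-! ### Rotations of a plane by a variable angle. -/

section Twist

variable {E : Type*} [NormedAddCommGroup E] [InnerProductSpace ℝ E]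

/-- Rotation by the angle `t` in the plane spanned by the orthonormal vectors `u`, `w`. -/
noncomputable def planeRotation (u w : E) (t : ℝ) (x : E) : E :=
  x + ((Real.cos t - 1) * inner ℝ u x - Real.sin t * inner ℝ w x) • u +
    (Real.sin t * inner ℝ u x + (Real.cos t - 1) * inner ℝ w x) • w

/-- The norm of the orthogonal projection to the plane spanned by the orthonormal vectors
`u`, `w`. -/
noncomputable def planeNorm (u w x : E) : ℝ := √(inner ℝ u x ^ 2 + inner ℝ w x ^ 2)

variable {u w : E}

theorem planeNorm_nonneg (x : E) : 0 ≤ planeNorm u w x := Real.sqrt_nonneg _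

theorem planeNorm_sq (x : E) : planeNorm u w x ^ 2 = inner ℝ u x ^ 2 + inner ℝ w x ^ 2 :=
  Real.sq_sqrt (by positivity)

variable (hu : ‖u‖ = 1) (hw : ‖w‖ = 1) (huw : inner ℝ u w = 0)

include hu huw in
theorem inner_left_planeRotation (t : ℝ) (x : E) : inner ℝ u (planeRotation u w t x) =
    Real.cos t * inner ℝ u x - Real.sin t * inner ℝ w x := by
  simp only [planeRotation, inner_add_right, inner_smul_right, huw, real_inner_self_eq_norm_sq, hu]
  ring

include hw huw in
theorem inner_right_planeRotation (t : ℝ) (x : E) : inner ℝ w (planeRotation u w t x) =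
    Real.sin t * inner ℝ u x + Real.cos t * inner ℝ w x := by
  simp only [planeRotation, inner_add_right, inner_smul_right, real_inner_comm u w, huw,
    real_inner_self_eq_norm_sq, hw]
  ring

include hu hw huw in
theorem norm_smul_add_smul_sq (a b : ℝ) : ‖a • u + b • w‖ ^ 2 = a ^ 2 + b ^ 2 := by
  rw [norm_add_sq_real, norm_smul, norm_smul, inner_smul_left, inner_smul_right, huw, hu, hw]
  simp

include hu hw huw in
theorem norm_planeRotation (t : ℝ) (x : E) : ‖planeRotation u w t x‖ = ‖x‖ := by
  rw [← sq_eq_sq₀ (norm_nonneg _) (norm_nonneg _), planeRotation, add_assoc, norm_add_sq_real,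
    norm_smul_add_smul_sq hu hw huw, inner_add_right, inner_smul_right, inner_smul_right,
    real_inner_comm u x, real_inner_comm w x]
  linear_combination (inner ℝ u x ^ 2 + inner ℝ w x ^ 2) * Real.sin_sq_add_cos_sq t

include hu hw huw in
theorem planeNorm_planeRotation (t : ℝ) (x : E) :
    planeNorm u w (planeRotation u w t x) = planeNorm u w x := by
  rw [planeNorm, inner_left_planeRotation hu huw, inner_right_planeRotation hw huw, planeNorm]
  congr 1
  linear_combination (inner ℝ u x ^ 2 + inner ℝ w x ^ 2) * Real.sin_sq_add_cos_sq t

theorem planeRotation_zero (x : E) : planeRotation u w 0 x = x := by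
  simp [planeRotation]

include hu hw huw in
theorem planeRotation_neg_planeRotation (t : ℝ) (x : E) :
    planeRotation u w (-t) (planeRotation u w t x) = x := by
  rw [planeRotation, inner_left_planeRotation hu huw, inner_right_planeRotation hw huw,
    planeRotation, Real.cos_neg, Real.sin_neg]
  match_scalars
  · ring
  · linear_combination inner ℝ u x * Real.sin_sq_add_cos_sq t
  · linear_combination inner ℝ w x * Real.sin_sq_add_cos_sq t

theorem planeRotation_sub (t : ℝ) (x y : E) :
    planeRotation u w t (x - y) = planeRotation u w t x - planeRotation u w t y := by
  simp only [planeRotation, inner_sub_right]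
  module

-- A chord of the unit circle is at most as long as its arc.
include hu hw huw in
theorem norm_planeRotation_sub_planeRotation_le (s t : ℝ) (x : E) :
    ‖planeRotation u w s x - planeRotation u w t x‖ ≤ |s - t| * planeNorm u w x := by
  have e : planeRotation u w s x - planeRotation u w t x =
      ((Real.cos s - Real.cos t) * inner ℝ u x - (Real.sin s - Real.sin t) * inner ℝ w x) • u +
      ((Real.sin s - Real.sin t) * inner ℝ u x + (Real.cos s - Real.cos t) * inner ℝ w x) • w := by
    simp only [planeRotation]
    module
  rw [← sq_le_sq₀ (norm_nonneg _) (mul_nonneg (abs_nonneg _) (planeNorm_nonneg _)), e,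
    norm_smul_add_smul_sq hu hw huw, mul_pow, sq_abs, planeNorm_sq]
  have h1 := Real.one_sub_sq_div_two_le_cos (x := s - t)
  rw [Real.cos_sub] at h1
  have h2 : (Real.cos s - Real.cos t) ^ 2 + (Real.sin s - Real.sin t) ^ 2 ≤ (s - t) ^ 2 := by
    nlinarith [Real.sin_sq_add_cos_sq s, Real.sin_sq_add_cos_sq t]
  have h3 := mul_le_mul_of_nonneg_right h2
    (show 0 ≤ inner ℝ u x ^ 2 + inner ℝ w x ^ 2 by positivity)
  linarith

theorem contDiff_planeRotation {g : E → ℝ} (hg : ContDiff ℝ ∞ g) :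
    ContDiff ℝ ∞ fun x => planeRotation u w (g x) x := by
  unfold planeRotation
  have h1 : ContDiff ℝ ∞ fun x : E => (inner ℝ u x : ℝ) := contDiff_const.inner ℝ contDiff_id
  have h2 : ContDiff ℝ ∞ fun x : E => (inner ℝ w x : ℝ) := contDiff_const.inner ℝ contDiff_id
  fun_prop

-- Rotating both points by the angle of the one farther from the axis is an isometry; the error is
-- then made at the nearer point, so only the smaller `planeNorm` enters.
include hu hw huw in
theorem norm_twist_sub_twist_le {g : E → ℝ} {κ : ℝ}
    (hg : ∀ x y, min (planeNorm u w x) (planeNorm u w y) * |g x - g y| ≤ κ * ‖x - y‖) (x y : E) :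
    ‖planeRotation u w (g x) x - planeRotation u w (g y) y‖ ≤ (1 + κ) * ‖x - y‖ := by
  wlog h : planeNorm u w y ≤ planeNorm u w x generalizing x y
  · rw [norm_sub_rev, norm_sub_rev x]
    exact this y x (le_of_not_ge h)
  have h1 := hg x y
  rw [min_eq_right h] at h1
  have e : planeRotation u w (g x) x - planeRotation u w (g y) y = planeRotation u w (g x) (x - y) +
      (planeRotation u w (g x) y - planeRotation u w (g y) y) := by
    rw [planeRotation_sub]; abel
  rw [e]
  refine (norm_add_le _ _).trans ?_
  rw [norm_planeRotation hu hw huw]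
  linarith [norm_planeRotation_sub_planeRotation_le hu hw huw (g x) (g y) y]

include hu hw huw in
/-- Rotating every point by an angle that is invariant under the rotations and varies slowly is
an almost isometric diffeomorphism. -/
theorem exists_twist {g : E → ℝ} {κ : ℝ} (hgs : ContDiff ℝ ∞ g)
    (hinv : ∀ t x, g (planeRotation u w t x) = g x)
    (hg : ∀ x y, min (planeNorm u w x) (planeNorm u w y) * |g x - g y| ≤ κ * ‖x - y‖) :
    ∃ Φ : E ≃ₘ[ℝ] E, IsBiLipschitz (1 + κ) Φ ∧ ∀ x, Φ x = planeRotation u w (g x) x := by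
  refine ⟨diffeomorphOfContDiff (fun x => planeRotation u w (g x) x)
    (fun x => planeRotation u w (-g x) x) ?_ ?_ (contDiff_planeRotation hgs)
    (contDiff_planeRotation hgs.neg), ⟨?_, ?_⟩, fun _ => rfl⟩
  · intro x
    simp only [hinv]
    exact planeRotation_neg_planeRotation hu hw huw _ _
  · intro x
    simp only [hinv]
    simpa using planeRotation_neg_planeRotation hu hw huw (-g x) x
  · exact norm_twist_sub_twist_le hu hw huw hg
  · refine norm_twist_sub_twist_le hu hw huw (g := fun x => -g x) fun x y => ?_
    rw [neg_sub_neg, abs_sub_comm]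
    exact hg x y

-- Since `a` and `b` differ only along `u`, it suffices to treat their coordinates as complex
-- numbers: these have equal modulus, hence differ by a factor `exp (θ * I)`.
include hu in
theorem exists_planeRotation_eq {a b : E} (hab : ‖a‖ = ‖b‖) {l : ℝ} (hd : a - b = l • u) :
    ∃ θ : ℝ, |θ| ≤ Real.pi ∧ planeRotation u w θ a = b := by
  have hb : b = a - l • u := by rw [← hd]; abel
  set p : ℝ := inner ℝ u a with hp
  set h : ℝ := inner ℝ w a with hh
  have hl : l * (l - 2 * p) = 0 := by
    have h1 : ‖b‖ ^ 2 = ‖a‖ ^ 2 - 2 * (l * p) + l ^ 2 := by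
      rw [hb, norm_sub_sq_real, inner_smul_right, real_inner_comm, norm_smul, hu]
      simp [hp]
    rw [hab] at h1
    linarith
  set za : ℂ := ⟨p, h⟩ with hza
  set zb : ℂ := ⟨p - l, h⟩ with hzb
  have hnorm : ‖za‖ = ‖zb‖ := by
    rw [← sq_eq_sq₀ (norm_nonneg _) (norm_nonneg _), ← Complex.normSq_eq_norm_sq,
      ← Complex.normSq_eq_norm_sq, Complex.normSq_mk, Complex.normSq_mk]
    linear_combination -hl
  obtain ⟨θ, hθ, hmul⟩ : ∃ θ : ℝ, |θ| ≤ Real.pi ∧ zb = Complex.exp (θ * Complex.I) * za := by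
    by_cases h0 : za = 0
    · refine ⟨0, by simp [Real.pi_pos.le], ?_⟩
      rw [h0, norm_zero] at hnorm
      simp [h0, norm_eq_zero.1 hnorm.symm]
    · refine ⟨(zb / za).arg, Complex.abs_arg_le_pi _, ?_⟩
      have := Complex.norm_mul_exp_arg_mul_I (zb / za)
      rw [norm_div, hnorm, div_self (by rw [← hnorm]; exact norm_ne_zero_iff.2 h0),
        Complex.ofReal_one, one_mul] at this
      rw [this, div_mul_cancel₀ _ h0]
  refine ⟨θ, hθ, ?_⟩
  have hre := congrArg Complex.re hmul
  have him := congrArg Complex.im hmul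
  rw [Complex.mul_re, Complex.exp_ofReal_mul_I_re, Complex.exp_ofReal_mul_I_im] at hre
  rw [Complex.mul_im, Complex.exp_ofReal_mul_I_re, Complex.exp_ofReal_mul_I_im] at him
  simp only [hza, hzb] at hre him
  rw [planeRotation, ← hp, ← hh, hb,
    show (Real.cos θ - 1) * p - Real.sin θ * h = -l by linarith,
    show Real.sin θ * p + (Real.cos θ - 1) * h = 0 by linarith]
  module

end Twist

/-! ### Small perturbations of the identity. -/

section Slide

variable {E : Type*} [NormedAddCommGroup E] [NormedSpace ℝ E] [CompleteSpace E]

/-- A contractive perturbation of the identity is a homeomorphism; its derivative is invertible by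
the Neumann series, so the inverse is smooth. -/
theorem exists_diffeomorph_id_add {h : E → E} {κ : ℝ} (hκ : 0 ≤ κ) (hκ1 : κ < 1)
    (hh : ContDiff ℝ ∞ h) (hlip : ∀ x y, ‖h x - h y‖ ≤ κ * ‖x - y‖) :
    ∃ Φ : E ≃ₘ[ℝ] E, IsBiLipschitz (1 - κ)⁻¹ Φ ∧ ∀ x, Φ x = x + h x := by
  have happ : ApproximatesLinearOn (fun x => x + h x)
      ((ContinuousLinearEquiv.refl ℝ E : E ≃L[ℝ] E) : E →L[ℝ] E) Set.univ ⟨κ, hκ⟩ := by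
    intro x _ y _
    have e : x + h x - (y + h y) - (x - y) = h x - h y := by abel
    change ‖x + h x - (y + h y) - (x - y)‖ ≤ κ * ‖x - y‖
    rw [e]
    exact hlip x y
  have hc : Subsingleton E ∨ (⟨κ, hκ⟩ : NNReal) <
      ‖((ContinuousLinearEquiv.refl ℝ E).symm : E →L[ℝ] E)‖₊⁻¹ := by
    rcases subsingleton_or_nontrivial E with hE | hE
    · exact Or.inl hE
    · right
      have : ‖((ContinuousLinearEquiv.refl ℝ E).symm : E →L[ℝ] E)‖₊ = 1 := by
        ext
        exact ContinuousLinearMap.norm_id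
      rw [this, inv_one]
      exact hκ1
  set F := happ.toHomeomorph _ hc with hF
  have hFx : ∀ x, F x = x + h x := fun x => rfl
  have hfd : ∀ x, ‖-fderiv ℝ h x‖ < 1 := fun x => by
    rw [norm_neg]
    exact (norm_fderiv_le_of_lip' ℝ hκ (Eventually.of_forall fun y => hlip y x)).trans_lt hκ1
  have hsymm : ContDiff ℝ ∞ F.symm := by
    refine F.contDiff_symm (f₀' := fun x => ContinuousLinearEquiv.unitsEquiv ℝ E
      (Units.oneSub (-fderiv ℝ h x) (hfd x))) (fun x => ?_) (contDiff_id.add hh)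
    have h1 := (hasFDerivAt_id x).add ((hh.differentiable (by simp)) x).hasFDerivAt
    refine h1.congr_fderiv ?_
    ext v
    simp
  have hpos : 0 < 1 - κ := by linarith
  have key : ∀ x y, ‖x - y‖ ≤ (1 - κ)⁻¹ * ‖F x - F y‖ := by
    intro x y
    rw [inv_mul_eq_div, le_div_iff₀ hpos, hFx, hFx]
    have h1 := norm_sub_le (x + h x - (y + h y)) (h x - h y)
    have e : x + h x - (y + h y) - (h x - h y) = x - y := by abel
    rw [e] at h1
    linarith [hlip x y]
  refine ⟨diffeomorphOfContDiff F F.symm F.symm_apply_apply F.apply_symm_apply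
    (contDiff_id.add hh) hsymm, ⟨fun x y => ?_, fun x y => ?_⟩, hFx⟩
  · change ‖x + h x - (y + h y)‖ ≤ _
    have e : x + h x - (y + h y) = (x - y) + (h x - h y) := by abel
    have h2 : 1 + κ ≤ (1 - κ)⁻¹ := by
      rw [← one_div, le_div_iff₀ hpos]
      nlinarith
    calc _ ≤ ‖x - y‖ + κ * ‖x - y‖ := by
          rw [e]
          exact (norm_add_le _ _).trans (by gcongr; exact hlip x y)
      _ = (1 + κ) * ‖x - y‖ := by ring
      _ ≤ _ := by gcongr
  · have h3 := key (F.symm x) (F.symm y)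
    rwa [F.apply_symm_apply, F.apply_symm_apply] at h3

/-- Nearby points can be moved to one another by an almost isometric diffeomorphism supported in
a small ball. -/
theorem exists_slide [FiniteDimensional ℝ E] [HasContDiffBump E] (b : E) {r q : ℝ} (hr : 0 < r)
    (hq : 1 < q) : ∃ σ : ℝ, 0 < σ ∧ ∀ c c', ‖c - b‖ < σ → ‖c' - b‖ < σ →
      ∃ Φ : E ≃ₘ[ℝ] E, IsBiLipschitz q Φ ∧ Φ c = c' ∧ ∀ x, r ≤ ‖x - b‖ → Φ x = x := by
  let φ : ContDiffBump b := ⟨r / 2, r, by linarith, by linarith⟩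
  obtain ⟨K, hK⟩ := ContDiff.lipschitzWith_of_hasCompactSupport (𝕂 := ℝ) φ.hasCompactSupport
    (φ.contDiff (n := 1)) (by simp)
  -- Chosen so that `(1 - κ)⁻¹ = q`.
  set κ := 1 - q⁻¹ with hκ
  have hκ0 : 0 < κ := by
    rw [hκ, sub_pos]
    exact inv_lt_one_of_one_lt₀ hq
  have hqi : 0 < q⁻¹ := inv_pos.2 (by linarith)
  refine ⟨min (r / 2) (κ / (2 * (K + 1))), by positivity, fun c c' hc hc' => ?_⟩
  have hv : ‖c' - c‖ ≤ κ / (K + 1) := by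
    have e : c' - c = (c' - b) - (c - b) := by abel
    rw [e]
    refine (norm_sub_le _ _).trans ?_
    have e2 : κ / (K + 1) = κ / (2 * (K + 1)) + κ / (2 * (K + 1)) := by field_simp; ring
    rw [e2]
    exact add_le_add (hc'.le.trans (min_le_right _ _)) (hc.le.trans (min_le_right _ _))
  obtain ⟨Φ, hΦ, hΦx⟩ := exists_diffeomorph_id_add (E := E) (h := fun x => φ x • (c' - c)) hκ0.le
    (by linarith) (φ.contDiff.smul contDiff_const) (fun x y => by
      rw [← sub_smul, norm_smul]
      calc ‖φ x - φ y‖ * ‖c' - c‖ ≤ (K * ‖x - y‖) * (κ / (K + 1)) := by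
            gcongr
            exact hK.norm_sub_le x y
        _ = κ * ‖x - y‖ * (K / (K + 1)) := by ring
        _ ≤ κ * ‖x - y‖ * 1 := by
            gcongr
            rw [div_le_one (by positivity)]
            linarith
        _ = _ := by ring)
  refine ⟨Φ, by simpa [hκ] using hΦ, ?_, fun x hx => ?_⟩
  · rw [hΦx, φ.one_of_mem_closedBall]
    · simp
    · rw [mem_closedBall_iff_norm]
      exact hc.le.trans (min_le_left _ _)
  · rw [hΦx, φ.zero_of_le_dist]
    · simp
    · rwa [dist_eq_norm]

end Slide

/-! ### Moving a point when the distances agree exactly. -/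

section ExactMove

variable {E : Type*} [NormedAddCommGroup E] [InnerProductSpace ℝ E]

theorem abs_planeNorm_sub_le {u w : E} (hu : ‖u‖ = 1) (hw : ‖w‖ = 1) (huw : inner ℝ u w = 0)
    (x y : E) : |planeNorm u w x - planeNorm u w y| ≤ ‖x - y‖ := by
  have hP : ∀ z, planeNorm u w z = ‖inner ℝ u z • u + inner ℝ w z • w‖ := fun z => by
    rw [planeNorm, ← norm_smul_add_smul_sq hu hw huw, Real.sqrt_sq (norm_nonneg _)]
  have hle : ∀ z, planeNorm u w z ≤ ‖z‖ := fun z => by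
    rw [← sq_le_sq₀ (planeNorm_nonneg _) (norm_nonneg _), planeNorm_sq]
    have h := norm_sub_sq_real z (inner ℝ u z • u + inner ℝ w z • w)
    rw [norm_smul_add_smul_sq hu hw huw, inner_add_right, inner_smul_right, inner_smul_right,
      real_inner_comm u z, real_inner_comm w z] at h
    nlinarith [sq_nonneg ‖z - (inner ℝ u z • u + inner ℝ w z • w)‖]
  refine le_trans ?_ (hle (x - y))
  rw [hP, hP, hP, inner_sub_right, inner_sub_right]
  refine (abs_norm_sub_norm_le _ _).trans_eq ?_
  congr 1
  module

theorem exists_unit_orthogonal [FiniteDimensional ℝ E] {n : ℕ} (v : Fin n → E)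
    (hn : n < Module.finrank ℝ E) : ∃ w : E, ‖w‖ = 1 ∧ ∀ i, inner ℝ (v i) w = 0 := by
  set K := Submodule.span ℝ (Set.range v) with hK
  have h1 : Module.finrank ℝ K ≤ n :=
    (finrank_range_le_card (R := ℝ) v).trans_eq (Fintype.card_fin n)
  have h2 : Kᗮ ≠ ⊥ := by
    intro h
    have h3 := K.finrank_add_finrank_orthogonal
    rw [h, finrank_bot] at h3
    omega
  obtain ⟨w, hw, hw0⟩ := Submodule.exists_mem_ne_zero_of_ne_bot h2
  refine ⟨‖w‖⁻¹ • w, norm_smul_inv_norm (𝕜 := ℝ) hw0, fun i => ?_⟩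
  rw [inner_smul_right, (K.mem_orthogonal w).1 hw _ (Submodule.subset_span ⟨i, rfl⟩), mul_zero]

/-- If `a` and `b` are equidistant from fewer than `dim E` points, one of them the origin, then an
almost isometric diffeomorphism takes `a` to `b`, is the identity near these points, and is the
identity outside a ball whose radius depends only on the distortion. -/
theorem exists_exact_move [FiniteDimensional ℝ E] {κ : ℝ} (hκ : 0 < κ) :
    ∃ N : ℝ, 2 ≤ N ∧ ∀ m : ℕ, m + 1 < Module.finrank ℝ E → ∀ (p : Fin (m + 1) → E) (a b : E),
      p 0 = 0 → ‖a‖ = 1 → (∀ i, ‖a - p i‖ = ‖b - p i‖) →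
      ∃ Φ : E ≃ₘ[ℝ] E, IsBiLipschitz (1 + κ) Φ ∧ Φ a = b ∧ (∀ i, ∀ᶠ y in 𝓝 (p i), Φ y = y) ∧
        ∀ x, N ≤ ‖x‖ → Φ x = x := by
  -- The angle is at most `π` in absolute value and is multiplied by two cutoffs.
  set κ' := κ / (2 * Real.pi) with hκ'
  have hpi := Real.pi_pos
  have hκ'0 : 0 < κ' := by positivity
  obtain ⟨c, hc0, hc1, f, hfs, hf01, hf0, hf1, hfl⟩ := exists_slow_cutoff hκ'0
  have hsc : 0 < √c := Real.sqrt_pos.2 hc0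
  have hN2 : 2 ≤ 2 / √c := by
    rw [le_div_iff₀ hsc]
    have : √c ≤ 1 := Real.sqrt_le_one.2 hc1.le
    linarith
  set N := 2 / √c with hN
  have hN0 : 0 < N := by positivity
  have hscale : ∀ R : ℝ, 0 < R → ∀ r s, 0 ≤ r → 0 ≤ s →
      min r s * |f (r ^ 2 / R ^ 2) - f (s ^ 2 / R ^ 2)| ≤ κ' * |r - s| := by
    intro R hR r s hr hs
    have h := hfl (r / R) (s / R) (by positivity) (by positivity)
    rw [div_pow, div_pow, min_div_div_right hR.le, ← sub_div, abs_div, abs_of_pos hR] at h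
    have h2 := mul_le_mul_of_nonneg_left h hR.le
    have e1 : R * (min r s / R * |f (r ^ 2 / R ^ 2) - f (s ^ 2 / R ^ 2)|) =
      min r s * |f (r ^ 2 / R ^ 2) - f (s ^ 2 / R ^ 2)| := by field_simp
    have e2 : R * (κ' * (|r - s| / R)) = κ' * |r - s| := by field_simp
    rwa [e1, e2] at h2
  refine ⟨N, hN2, fun m hm p a b hp0 ha hab => ?_⟩
  by_cases hne : a = b
  · exact ⟨Diffeomorph.refl 𝓘(ℝ, E) E ∞, isBiLipschitz_refl (by linarith), hne,
      fun i => Eventually.of_forall fun _ => rfl, fun _ _ => rfl⟩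
  have hd : a - b ≠ 0 := sub_ne_zero.2 hne
  have hab0 : ‖a‖ = ‖b‖ := by simpa [hp0] using hab 0
  -- As `p 0 = 0` imposes no condition, its slot is given to `a - b`, so `m + 1` vectors suffice.
  obtain ⟨w, hw, hwp⟩ := exists_unit_orthogonal (Function.update p 0 (a - b)) hm
  have hwd : inner ℝ (a - b) w = 0 := by simpa using hwp 0
  have hwpi : ∀ i, inner ℝ w (p i) = 0 := by
    intro i
    by_cases hi : i = 0
    · rw [hi, hp0, inner_zero_right]
    · have := hwp i
      rwa [Function.update_of_ne hi, real_inner_comm] at this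
  set u := ‖a - b‖⁻¹ • (a - b) with hu_def
  have hu : ‖u‖ = 1 := norm_smul_inv_norm (𝕜 := ℝ) hd
  have huw : inner ℝ u w = 0 := by rw [hu_def, inner_smul_left, hwd, mul_zero]
  have hdu : a - b = ‖a - b‖ • u := by
    rw [hu_def, smul_smul, mul_inv_cancel₀ (norm_ne_zero_iff.2 hd), one_smul]
  -- Expanding `‖a - p i‖ = ‖b - p i‖` with `‖a‖ = ‖b‖` leaves `⟪a - b, p i⟫ = 0`.
  have hupi : ∀ i, inner ℝ u (p i) = 0 := by
    intro i
    have h1 := congrArg (· ^ 2) (hab i)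
    simp only [norm_sub_sq_real, hab0] at h1
    rw [hu_def, inner_smul_left, inner_sub_left, show inner ℝ a (p i) - inner ℝ b (p i) = (0 : ℝ)
      by linarith, mul_zero]
  -- So `a` is off the axis of rotation, and its distance `ρ` to the axis can serve as a cutoff
  -- scale.
  have hua : inner ℝ u a ≠ 0 := by
    have h1 : inner ℝ (a - b) a = ‖a - b‖ ^ 2 / 2 := by
      rw [norm_sub_sq_real, inner_sub_left, real_inner_self_eq_norm_sq, hab0, real_inner_comm]
      ring
    rw [hu_def, inner_smul_left, h1]
    have := norm_pos_iff.2 hd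
    simp only [conj_trivial]
    positivity
  obtain ⟨θ, hθ, hrot⟩ := exists_planeRotation_eq (w := w) hu hab0 hdu
  set ρ := planeNorm u w a with hρ
  have hρ0 : 0 < ρ := Real.sqrt_pos.2 (by positivity)
  -- The first factor vanishes near the axis, which contains every `p i`; the second vanishes for `N
  -- ≤ ‖x‖`. Both equal `1` at `a`, the second because `1 / N² = c / 4 ≤ c`.
  set g : E → ℝ := fun x => θ * (f (planeNorm u w x ^ 2 / ρ ^ 2) * (1 - f (‖x‖ ^ 2 / N ^ 2)))
    with hg
  have hgs : ContDiff ℝ ∞ g := by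
    have h1 : ContDiff ℝ ∞ fun x => f (planeNorm u w x ^ 2 / ρ ^ 2) := by
      rw [contDiff_iff_contDiffAt]
      intro x
      have h2 : ContDiff ℝ ∞ fun x => planeNorm u w x ^ 2 / ρ ^ 2 := by
        simp only [planeNorm_sq]
        have h1 : ContDiff ℝ ∞ fun x : E => (inner ℝ u x : ℝ) := contDiff_const.inner ℝ contDiff_id
        have h2 : ContDiff ℝ ∞ fun x : E => (inner ℝ w x : ℝ) := contDiff_const.inner ℝ contDiff_id
        fun_prop
      exact (hfs _ (by positivity)).comp x h2.contDiffAt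
    have h3 : ContDiff ℝ ∞ fun x : E => f (‖x‖ ^ 2 / N ^ 2) := by
      rw [contDiff_iff_contDiffAt]
      intro x
      exact (hfs _ (by positivity)).comp x ((contDiff_norm_sq ℝ).div_const _).contDiffAt
    exact contDiff_const.mul (h1.mul (contDiff_const.sub h3))
  have hginv : ∀ t x, g (planeRotation u w t x) = g x := by
    intro t x
    simp only [hg, planeNorm_planeRotation hu hw huw, norm_planeRotation hu hw huw]
  have hglip : ∀ x y, min (planeNorm u w x) (planeNorm u w y) * |g x - g y| ≤ κ * ‖x - y‖ := by
    intro x y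
    have hPle : ∀ z, planeNorm u w z ≤ ‖z‖ := fun z => by
      simpa [planeNorm, abs_of_nonneg (Real.sqrt_nonneg _)] using
        abs_planeNorm_sub_le hu hw huw z 0
    set P := min (planeNorm u w x) (planeNorm u w y) with hP
    have hP0 : 0 ≤ P := le_min (planeNorm_nonneg _) (planeNorm_nonneg _)
    have h1 := (hscale ρ hρ0 _ _ (planeNorm_nonneg x) (planeNorm_nonneg y)).trans
      (mul_le_mul_of_nonneg_left (abs_planeNorm_sub_le hu hw huw x y) hκ'0.le)
    have h2 := (hscale N hN0 _ _ (norm_nonneg x) (norm_nonneg y)).trans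
      (mul_le_mul_of_nonneg_left (abs_norm_sub_norm_le x y) hκ'0.le)
    have h3 := (mul_le_mul_of_nonneg_right (min_le_min (hPle x) (hPle y))
      (abs_nonneg (f (‖x‖ ^ 2 / N ^ 2) - f (‖y‖ ^ 2 / N ^ 2)))).trans h2
    simp only [hg]
    set A := f (planeNorm u w x ^ 2 / ρ ^ 2)
    set A' := f (planeNorm u w y ^ 2 / ρ ^ 2)
    obtain ⟨hB0, hB1⟩ := hf01 (‖x‖ ^ 2 / N ^ 2)
    obtain ⟨hA0, hA1⟩ := hf01 (planeNorm u w y ^ 2 / ρ ^ 2)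
    set B := f (‖x‖ ^ 2 / N ^ 2)
    set B' := f (‖y‖ ^ 2 / N ^ 2)
    have h4 : |A * (1 - B) - A' * (1 - B')| ≤ |A - A'| + |B - B'| := by
      have e : A * (1 - B) - A' * (1 - B') = (A - A') * (1 - B) + -(A' * (B - B')) := by ring
      rw [e]
      refine (abs_add_le _ _).trans ?_
      rw [abs_neg, abs_mul, abs_mul]
      refine add_le_add (mul_le_of_le_one_right (abs_nonneg _) ?_)
        (mul_le_of_le_one_left (abs_nonneg _) ?_)
      · rw [abs_le]; constructor <;> linarith
      · rw [abs_le]; constructor <;> linarith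
    rw [← mul_sub, abs_mul]
    calc P * (|θ| * |A * (1 - B) - A' * (1 - B')|) ≤ P * (Real.pi * (|A - A'| + |B - B'|)) := by
          gcongr
      _ = Real.pi * (P * |A - A'| + P * |B - B'|) := by ring
      _ ≤ Real.pi * (κ' * ‖x - y‖ + κ' * ‖x - y‖) := by gcongr
      _ = κ * ‖x - y‖ := by rw [hκ']; field_simp; ring
  obtain ⟨Φ, hΦ, hΦx⟩ := exists_twist hu hw huw hgs hginv hglip
  have hfix : ∀ x, g x = 0 → Φ x = x := fun x hx => by rw [hΦx, hx, planeRotation_zero]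
  refine ⟨Φ, hΦ, ?_, fun i => ?_, fun x hx => hfix x ?_⟩
  · rw [hΦx]
    have : g a = θ := by
      simp only [hg]
      rw [← hρ, div_self (by positivity), hf1 1 le_rfl, hf0 (‖a‖ ^ 2 / N ^ 2) (by positivity)]
      · ring
      · rw [ha, hN, div_pow, Real.sq_sqrt hc0.le, one_pow]
        field_simp
        norm_num
    rw [this, hrot]
  · have hcont : Continuous fun y => planeNorm u w y ^ 2 / ρ ^ 2 := by
      unfold planeNorm
      fun_prop
    have h0 : planeNorm u w (p i) ^ 2 / ρ ^ 2 < c := by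
      rw [planeNorm_sq, hupi, hwpi]
      simpa using hc0
    filter_upwards [hcont.continuousAt.eventually_lt_const h0] with y hy
    refine hfix y ?_
    simp only [hg]
    rw [hf0 (planeNorm u w y ^ 2 / ρ ^ 2) (by positivity) hy.le]
    ring
  · simp only [hg]
    rw [hf1 (‖x‖ ^ 2 / N ^ 2)]
    · ring
    · rw [one_le_div (by positivity)]
      gcongr

end ExactMove

/-! ### Moving a point when the distances almost agree. -/

section PointMove

variable {E : Type*} [NormedAddCommGroup E] [InnerProductSpace ℝ E] [FiniteDimensional ℝ E]

/-- Compactness: counterexamples with `δ = 1 / (n + 1)` subconverge to an exact configuration. The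
exact move is the identity near each limit point, so it fixes the nearby `p i`, and it brings `a`
close to `b`. That `N` is independent of the configuration keeps the sequence bounded. -/
theorem exists_move_of_norm_le {q : ℝ} (hq : 1 < q) :
    ∃ N : ℝ, 2 ≤ N ∧ ∀ m : ℕ, m + 1 < Module.finrank ℝ E → ∃ δ : ℝ, 0 < δ ∧
      ∀ (p : Fin (m + 1) → E) (a b : E), p 0 = 0 → ‖a‖ = 1 → (∀ i, ‖p i‖ ≤ N) →
      (∀ i, 1 ≤ ‖a - p i‖) →
      (∀ i, ‖a - p i‖ ≤ (1 + δ) * ‖b - p i‖ ∧ ‖b - p i‖ ≤ (1 + δ) * ‖a - p i‖) →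
      ∃ Φ : E ≃ₘ[ℝ] E, IsBiLipschitz q Φ ∧ Φ a = b ∧ (∀ i, Φ (p i) = p i) ∧
        ∀ x, N ≤ ‖x‖ → Φ x = x := by
  have hsq : 1 < √q := by rwa [Real.lt_sqrt zero_le_one, one_pow]
  obtain ⟨N, hN2, hN⟩ := exists_exact_move (E := E) (sub_pos.2 hsq)
  refine ⟨N, hN2, fun m hm => ?_⟩
  by_contra hcon
  have hseq : ∀ n : ℕ, ∃ c : (Fin (m + 1) → E) × E × E, (c.1 0 = 0 ∧ ‖c.2.1‖ = 1 ∧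
      (∀ i, ‖c.1 i‖ ≤ N) ∧ (∀ i, 1 ≤ ‖c.2.1 - c.1 i‖) ∧
      (∀ i, ‖c.2.1 - c.1 i‖ ≤ (1 + 1 / ((n : ℝ) + 1)) * ‖c.2.2 - c.1 i‖ ∧
        ‖c.2.2 - c.1 i‖ ≤ (1 + 1 / ((n : ℝ) + 1)) * ‖c.2.1 - c.1 i‖)) ∧
      ¬ ∃ Φ : E ≃ₘ[ℝ] E, IsBiLipschitz q Φ ∧ Φ c.2.1 = c.2.2 ∧ (∀ i, Φ (c.1 i) = c.1 i) ∧
        ∀ x, N ≤ ‖x‖ → Φ x = x := by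
    intro n
    by_contra h
    exact hcon ⟨1 / ((n : ℝ) + 1), by positivity, fun p a b h1 h2 h3 h4 h5 =>
      by_contra fun hΦ => h ⟨(p, a, b), ⟨h1, h2, h3, h4, h5⟩, hΦ⟩⟩
  choose c hc hno using hseq
  have hbdd : ∀ n, c n ∈ Metric.closedBall (0 : (Fin (m + 1) → E) × E × E) N := by
    intro n
    obtain ⟨h0, h1, h2, -, h4⟩ := hc n
    rw [mem_closedBall_zero_iff, Prod.norm_def, Prod.norm_def]
    refine max_le ((pi_norm_le_iff_of_nonneg (by linarith)).2 h2) (max_le (by linarith) ?_)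
    have h5 := (h4 0).2
    rw [h0, sub_zero, sub_zero, h1, mul_one] at h5
    have h6 : 1 / ((n : ℝ) + 1) ≤ 1 := by
      rw [div_le_one (by positivity)]
      linarith [(Nat.cast_nonneg n : (0 : ℝ) ≤ n)]
    linarith
  obtain ⟨⟨p, a, b⟩, -, φ, hφ, hlim⟩ := tendsto_subseq_of_bounded Metric.isBounded_closedBall hbdd
  have hδ : Tendsto (fun n => 1 + 1 / ((φ n : ℝ) + 1)) atTop (𝓝 1) := by
    simpa using (tendsto_one_div_add_atTop_nhds_zero_nat.comp hφ.tendsto_atTop).const_add (1 : ℝ)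
  have hp : ∀ i, Tendsto (fun n => (c (φ n)).1 i) atTop (𝓝 (p i)) := fun i =>
    tendsto_pi_nhds.1 ((continuous_fst.tendsto _).comp hlim) i
  have ha : Tendsto (fun n => (c (φ n)).2.1) atTop (𝓝 a) :=
    ((continuous_fst.comp continuous_snd).tendsto _).comp hlim
  have hb : Tendsto (fun n => (c (φ n)).2.2) atTop (𝓝 b) :=
    ((continuous_snd.comp continuous_snd).tendsto _).comp hlim
  have hap := fun i => (ha.sub (hp i)).norm
  have hbp := fun i => (hb.sub (hp i)).norm
  have hp0 : p 0 = 0 := tendsto_nhds_unique (hp 0) (by simp [(hc _).1])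
  have ha1 : ‖a‖ = 1 := tendsto_nhds_unique ha.norm (by simp [(hc _).2.1])
  have hap1 : ∀ i, 1 ≤ ‖a - p i‖ := fun i => ge_of_tendsto' (hap i) fun n => (hc (φ n)).2.2.2.1 i
  have hab : ∀ i, ‖a - p i‖ = ‖b - p i‖ := by
    intro i
    apply le_antisymm
    · simpa using le_of_tendsto_of_tendsto' (hap i) (hδ.mul (hbp i))
        fun n => ((hc (φ n)).2.2.2.2 i).1
    · simpa using le_of_tendsto_of_tendsto' (hbp i) (hδ.mul (hap i))
        fun n => ((hc (φ n)).2.2.2.2 i).2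
  have hb1 : ‖b‖ = 1 := by simpa [hp0, ha1, eq_comm] using hab 0
  obtain ⟨Ψ, hΨ, hΨa, hΨp, hΨN⟩ := hN m hm p a b hp0 ha1 hab
  -- Radius `1 / 2` keeps the slide away from the `p i`, whose limits are at distance at least `1`
  -- from `b`, and inside the ball of radius `N ≥ 2`, since `‖b‖ = 1`.
  obtain ⟨σ, hσ, hslide⟩ := exists_slide b (r := 1 / 2) (by norm_num) hsq
  have hΨa' : Tendsto (fun n => Ψ (c (φ n)).2.1) atTop (𝓝 b) := by
    have := (Ψ.continuous.tendsto a).comp ha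
    rwa [hΨa] at this
  have hfix : ∀ᶠ n in atTop, ∀ i, Ψ ((c (φ n)).1 i) = (c (φ n)).1 i :=
    eventually_all.2 fun i => (hp i).eventually (hΨp i)
  have hfar : ∀ᶠ n in atTop, ∀ i, 1 / 2 < ‖b - (c (φ n)).1 i‖ := by
    refine eventually_all.2 fun i =>
      (tendsto_const_nhds.sub (hp i)).norm.eventually_const_lt ?_
    rw [← hab]
    linarith [hap1 i]
  have near : ∀ {s : ℕ → E}, Tendsto s atTop (𝓝 b) → ∀ᶠ n in atTop, ‖s n - b‖ < σ := by
    intro s hs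
    filter_upwards [Metric.tendsto_nhds.1 hs σ hσ] with n hn
    rwa [← dist_eq_norm]
  obtain ⟨n, h1, h2, h3, h4⟩ := (hfix.and (hfar.and ((near hΨa').and (near hb)))).exists
  obtain ⟨Θ, hΘ, hΘa, hΘf⟩ := hslide _ _ h3 h4
  refine hno (φ n) ⟨Ψ.trans Θ, hΨ.trans hΘ (by linarith) (by linarith) ?_, hΘa, fun i => ?_,
    fun x hx => ?_⟩
  · rw [add_sub_cancel, Real.mul_self_sqrt (by linarith)]
  · rw [Diffeomorph.coe_trans, Function.comp_apply, h1 i, hΘf _ ?_]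
    rw [norm_sub_rev]
    exact (h2 i).le
  · rw [Diffeomorph.coe_trans, Function.comp_apply, hΨN x hx, hΘf _ ?_]
    have := norm_sub_norm_le x b
    linarith

/-- A point can be moved almost isometrically to another one that has almost the same distances to
fewer than `dim E` fixed points. -/
theorem exists_move {q : ℝ} (hq : 1 < q) :
    ∃ N : ℝ, 2 ≤ N ∧ ∀ m : ℕ, m + 1 < Module.finrank ℝ E → ∃ δ : ℝ, 0 < δ ∧
      ∀ (p : Fin (m + 1) → E) (a b : E), (∀ i, a ≠ p i) →
      (∀ i, ‖a - p i‖ ≤ (1 + δ) * ‖b - p i‖ ∧ ‖b - p i‖ ≤ (1 + δ) * ‖a - p i‖) →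
      ∃ Φ : E ≃ₘ[ℝ] E, IsBiLipschitz q Φ ∧ Φ a = b ∧ (∀ i, Φ (p i) = p i) ∧
        ∀ x, (∀ i, N * ‖a - p i‖ ≤ ‖x - p i‖) → Φ x = x := by
  obtain ⟨N, hN2, hN⟩ := exists_move_of_norm_le (E := E) hq
  refine ⟨N, hN2, fun m hm => ?_⟩
  obtain ⟨δ, hδ, hmove⟩ := hN m hm
  refine ⟨δ, hδ, fun p a b hne hab => ?_⟩
  -- The point nearest to `a` becomes the origin, at distance `1` after rescaling.
  obtain ⟨j, hj⟩ := Finite.exists_min fun i => ‖a - p i‖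
  set r := ‖a - p j‖ with hr
  have hr0 : 0 < r := norm_pos_iff.2 (sub_ne_zero.2 (hne j))
  set T : E → E := fun x => r⁻¹ • (x - p j) with hT
  have hTn : ∀ x y, ‖T x - T y‖ = r⁻¹ * ‖x - y‖ := fun x y => by
    rw [← smul_sub, sub_sub_sub_cancel_right, norm_smul, Real.norm_of_nonneg (inv_pos.2 hr0).le]
  have hTj : T (p j) = 0 := by simp [hT]
  -- The swap puts `j` in slot `0`. Points beyond radius `N` are replaced by `p j`: they lie where
  -- the map is the identity anyway.
  set p' : Fin (m + 1) → Fin (m + 1) := fun i =>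
    if ‖T (p (Equiv.swap 0 j i))‖ ≤ N then Equiv.swap 0 j i else j with hp'
  have key : ∃ Φ : E ≃ₘ[ℝ] E, IsBiLipschitz q Φ ∧ Φ (T a) = T b ∧
      (∀ i, Φ (T (p (p' i))) = T (p (p' i))) ∧ ∀ x, N ≤ ‖x‖ → Φ x = x := by
    apply hmove (fun i => T (p (p' i))) (T a) (T b)
    · have : p' 0 = j := by simp [hp']
      rw [this, hTj]
    · rw [← sub_zero (T a), ← hTj, hTn, ← hr, inv_mul_cancel₀ hr0.ne']
    · intro i
      by_cases hi : ‖T (p (Equiv.swap 0 j i))‖ ≤ N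
      · simp [hp', hi]
      · simp only [hp', hi, if_false, hTj, norm_zero]
        linarith
    · intro i
      rw [hTn, inv_mul_eq_div, one_le_div hr0]
      exact hj _
    · intro i
      have hri := (inv_pos.2 hr0).le
      rw [hTn, hTn, mul_left_comm, mul_left_comm (1 + δ)]
      exact ⟨mul_le_mul_of_nonneg_left (hab _).1 hri, mul_le_mul_of_nonneg_left (hab _).2 hri⟩
  obtain ⟨Φ, hΦ, hΦa, hΦp, hΦN⟩ := key
  obtain ⟨Ψ, hΨ, hΨx⟩ := hΦ.exists_conj (p j) hr0
  have hTinv : ∀ x, p j + r • T x = x := fun x => by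
    rw [hT, smul_smul, mul_inv_cancel₀ hr0.ne', one_smul, add_sub_cancel]
  have hfix : ∀ x, Φ (T x) = T x → Ψ x = x := fun x hx => by
    rw [hΨx]
    change p j + r • Φ (T x) = x
    rw [hx, hTinv]
  refine ⟨Ψ, hΨ, ?_, fun i => hfix _ ?_, fun x hx => hfix _ (hΦN _ ?_)⟩
  · rw [hΨx]
    change p j + r • Φ (T a) = b
    rw [hΦa, hTinv]
  · by_cases hi : ‖T (p i)‖ ≤ N
    · have := hΦp (Equiv.swap 0 j i)
      simpa [hp', hi] using this
    · exact hΦN _ (le_of_not_ge hi)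
  · have h1 := hTn x (p j)
    rw [hTj, sub_zero] at h1
    rw [h1, inv_mul_eq_div, le_div_iff₀ hr0]
    exact hx j

end PointMove

/-! ### Induction on the number of points. -/

section Interpolation

/-- Every `δ`-almost isometric map defined on `m + 1` points of `E` and fixing the first of them
extends to a `q`-bi-Lipschitz diffeomorphism that is the identity outside the ball about this point
whose radius is `M` times that of the family. -/
def HasAlmostIsometricExtension (E : Type*) [NormedAddCommGroup E] [NormedSpace ℝ E]
    (q M δ : ℝ) (m : ℕ) : Prop :=
  ∀ y z : Fin (m + 1) → E, Function.Injective y → y 0 = z 0 →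
    (∀ i j, ‖z i - z j‖ ≤ (1 + δ) * ‖y i - y j‖ ∧ ‖y i - y j‖ ≤ (1 + δ) * ‖z i - z j‖) →
    ∀ B, (∀ i, ‖y i - y 0‖ ≤ B) → ∃ Φ : E ≃ₘ[ℝ] E, IsBiLipschitz q Φ ∧ (∀ i, Φ (y i) = z i) ∧
      ∀ x, M * B ≤ ‖x - y 0‖ → Φ x = x

theorem HasAlmostIsometricExtension.mono {E : Type*} [NormedAddCommGroup E] [NormedSpace ℝ E]
    {q M M' δ δ' : ℝ} {m : ℕ} (h : HasAlmostIsometricExtension E q M δ m) (hM : M ≤ M')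
    (hδ : δ' ≤ δ) : HasAlmostIsometricExtension E q M' δ' m := by
  intro y z hy h0 hyz B hB
  have hB0 : 0 ≤ B := (norm_nonneg _).trans (hB 0)
  obtain ⟨Φ, h1, h2, h3⟩ := h y z hy h0 (fun i j =>
    ⟨(hyz i j).1.trans (by gcongr), (hyz i j).2.trans (by gcongr)⟩) B hB
  exact ⟨Φ, h1, h2, fun x hx => h3 x (le_trans (by gcongr) hx)⟩

variable {E : Type*} [NormedAddCommGroup E] [InnerProductSpace ℝ E] [FiniteDimensional ℝ E]

/-- The last point is corrected by `exists_move` after the others have been matched. The bound must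
hold for all `q`, since the induction hypothesis is applied with a smaller constant. -/
theorem exists_hasAlmostIsometricExtension (m : ℕ) (hm : m < Module.finrank ℝ E) :
    ∀ q : ℝ, 1 < q → ∃ M δ : ℝ, 0 < M ∧ 0 < δ ∧ HasAlmostIsometricExtension E q M δ m := by
  induction m with
  | zero =>
    refine fun q hq => ⟨1, 1, one_pos, one_pos, fun y z _ h0 _ B _ =>
      ⟨Diffeomorph.refl 𝓘(ℝ, E) E ∞, isBiLipschitz_refl hq.le, fun i => ?_, fun _ _ => rfl⟩⟩
    rw [Fin.fin_one_eq_zero i]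
    exact h0
  | succ m ih =>
    intro q hq
    have hsq : 1 < √q := by rwa [Real.lt_sqrt zero_le_one, one_pow]
    obtain ⟨N, hN2, hN⟩ := exists_move (E := E) hsq
    obtain ⟨α, hα, hmove⟩ := hN m hm
    have hsα : 1 < √(1 + α) := by
      rw [Real.lt_sqrt zero_le_one]
      linarith
    -- The bound `√q` leaves room for composing, `√(1 + α)` makes the distances to the `p i`
    -- accurate to `1 + α`, and `2` controls the support.
    set q₁ := min √q (min √(1 + α) 2) with hq₁
    have hq₁1 : 1 < q₁ := lt_min hsq (lt_min hsα one_lt_two)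
    have hq₁q : q₁ ≤ √q := min_le_left _ _
    have hq₁α : q₁ ≤ √(1 + α) := (min_le_right _ _).trans (min_le_left _ _)
    have hq₁2 : q₁ ≤ 2 := (min_le_right _ _).trans (min_le_right _ _)
    obtain ⟨M, δ, hM, hδ, hext⟩ := ih (by omega) q₁ hq₁1
    -- The correction needs `‖x - z i‖ ≥ N * (q₁ * (2 * B))`, at most `4 * N * B`, and each `z i` is
    -- within `2 * B` of `y 0`.
    refine ⟨M + 4 * N + 2, min δ (min (√(1 + α) - 1) 1), by linarith,
      lt_min hδ (lt_min (by linarith) one_pos), ?_⟩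
    intro y z hy h0 hyz B hB
    set δ' := min δ (min (√(1 + α) - 1) 1) with hδ'
    have hδ'0 : 0 < δ' := lt_min hδ (lt_min (by linarith) one_pos)
    have hδ'α : 1 + δ' ≤ √(1 + α) := by
      linarith [(min_le_right δ _).trans (min_le_left (√(1 + α) - 1) 1)]
    have hδ'1 : δ' ≤ 1 := (min_le_right _ _).trans (min_le_right _ _)
    have hqδ : q₁ * (1 + δ') ≤ 1 + α :=
      (mul_le_mul hq₁α hδ'α (by linarith) (Real.sqrt_nonneg _)).trans_eq
        (Real.mul_self_sqrt (by linarith))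
    have hB0 : 0 ≤ B := (norm_nonneg _).trans (hB 0)
    obtain ⟨Φ, hΦ, hΦy, hΦf⟩ := hext.mono le_rfl (min_le_left _ _)
      (fun i => y i.castSucc) (fun i => z i.castSucc)
      (hy.comp (Fin.castSucc_injective _)) h0 (fun i j => hyz _ _) B (fun i => hB _)
    set l := Fin.last (m + 1)
    have hle : ∀ i : Fin (m + 1), ‖Φ (y l) - z i.castSucc‖ ≤ q₁ * ‖y l - y i.castSucc‖ := by
      intro i
      rw [← hΦy i]
      exact hΦ.1 _ _
    have hge : ∀ i : Fin (m + 1), ‖y l - y i.castSucc‖ ≤ q₁ * ‖Φ (y l) - z i.castSucc‖ := by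
      intro i
      rw [← hΦy i]
      simpa only [Φ.symm_apply_apply] using hΦ.2 (Φ (y l)) (Φ (y i.castSucc))
    obtain ⟨Ψ, hΨ, hΨa, hΨz, hΨf⟩ := hmove (fun i => z i.castSucc) (Φ (y l)) (z l) (fun i h => by
        rw [← hΦy i] at h
        exact (Fin.castSucc_lt_last i).ne' (hy (Φ.injective h))) (fun i => by
        constructor
        · calc _ ≤ q₁ * ((1 + δ') * ‖z l - z i.castSucc‖) :=
                (hle i).trans (mul_le_mul_of_nonneg_left (hyz _ _).2 (by linarith))
            _ = (q₁ * (1 + δ')) * ‖z l - z i.castSucc‖ := by ring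
            _ ≤ _ := by gcongr
        · calc _ ≤ (1 + δ') * (q₁ * ‖Φ (y l) - z i.castSucc‖) :=
                (hyz _ _).1.trans (mul_le_mul_of_nonneg_left (hge i) (by linarith))
            _ = (q₁ * (1 + δ')) * ‖Φ (y l) - z i.castSucc‖ := by ring
            _ ≤ _ := by gcongr)
    refine ⟨Φ.trans Ψ, hΦ.trans hΨ (by linarith) (by linarith) ?_, fun i => ?_, fun x hx => ?_⟩
    · calc q₁ * √q ≤ √q * √q := by gcongr
        _ = q := Real.mul_self_sqrt (by linarith)
    · rw [Diffeomorph.coe_trans, Function.comp_apply]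
      induction i using Fin.lastCases with
      | last => exact hΨa
      | cast i => rw [hΦy i, hΨz i]
    · rw [Diffeomorph.coe_trans, Function.comp_apply, hΦf x ?_, hΨf x fun i => ?_]
      · have h1 : ‖y l - y i.castSucc‖ ≤ 2 * B := by
          have := norm_sub_le (y l - y 0) (y i.castSucc - y 0)
          rw [sub_sub_sub_cancel_right] at this
          linarith [hB l, hB i.castSucc]
        have h2 : ‖z i.castSucc - y 0‖ ≤ 2 * B := by
          rw [h0]
          refine (hyz _ _).1.trans ?_
          have := hB i.castSucc
          gcongr
          linarith
        have h3 := norm_sub_le_norm_sub_add_norm_sub x (z i.castSucc) (y 0)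
        have h4 : N * ‖Φ (y l) - z i.castSucc‖ ≤ N * (2 * (2 * B)) := by
          refine mul_le_mul_of_nonneg_left ((hle i).trans ?_) (by linarith)
          gcongr
        have h5 : 0 ≤ M * B := by positivity
        linarith
      · refine le_trans ?_ hx
        gcongr
        linarith

theorem exists_hasAlmostIsometricExtension_of_lt {q : ℝ} (hq : 1 < q) (n : ℕ)
    (hn : n ≤ Module.finrank ℝ E) : ∃ M δ : ℝ, 0 < M ∧ 0 < δ ∧
      ∀ m < n, HasAlmostIsometricExtension E q M δ m := by
  induction n with
  | zero => exact ⟨1, 1, one_pos, one_pos, fun m hm => absurd hm m.not_lt_zero⟩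
  | succ n ih =>
    obtain ⟨M, δ, hM, hδ, h⟩ := ih (by omega)
    obtain ⟨M', δ', hM', hδ', h'⟩ := exists_hasAlmostIsometricExtension (E := E) n
      (by omega) q hq
    refine ⟨max M M', min δ δ', lt_max_of_lt_left hM, lt_min hδ hδ', fun m hm => ?_⟩
    rcases Nat.lt_succ_iff_lt_or_eq.1 hm with hm | rfl
    · exact (h m hm).mono (le_max_left _ _) (min_le_left _ _)
    · exact h'.mono (le_max_right _ _) (min_le_right _ _)

end Interpolation

/-! ### From bi-Lipschitz bounds to the Jacobian matrix. -/

section Distortion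

/-- The lower bound is the upper bound for the inverse map, through the chain rule. -/
theorem IsBiLipschitz.norm_fderiv_apply {E : Type*} [NormedAddCommGroup E] [NormedSpace ℝ E]
    {q : ℝ} {Φ : E ≃ₘ[ℝ] E} (h : IsBiLipschitz q Φ) (hq : 0 ≤ q) (x v : E) :
    ‖fderiv ℝ Φ x v‖ ≤ q * ‖v‖ ∧ ‖v‖ ≤ q * ‖fderiv ℝ Φ x v‖ := by
  have h1 : ‖fderiv ℝ Φ x‖ ≤ q :=
    norm_fderiv_le_of_lip' ℝ hq (Filter.Eventually.of_forall fun y => h.1 y x)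
  have h2 : ‖fderiv ℝ Φ.symm (Φ x)‖ ≤ q :=
    norm_fderiv_le_of_lip' ℝ hq (Filter.Eventually.of_forall fun y => h.2 y (Φ x))
  refine ⟨(fderiv ℝ Φ x).le_of_opNorm_le h1 v, ?_⟩
  have hd : DifferentiableAt ℝ Φ x := Φ.contDiff.differentiable (by simp) x
  have hd' : DifferentiableAt ℝ Φ.symm (Φ x) := Φ.symm.contDiff.differentiable (by simp) (Φ x)
  have hcomp := hd'.hasFDerivAt.comp x hd.hasFDerivAt
  have hid : (Φ.symm ∘ Φ : E → E) = id := funext Φ.symm_apply_apply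
  rw [hid] at hcomp
  have hv := DFunLike.congr_fun (hcomp.unique (hasFDerivAt_id x)) v
  have h3 := (fderiv ℝ Φ.symm (Φ x)).le_of_opNorm_le h2 (fderiv ℝ Φ x v)
  rwa [← ContinuousLinearMap.comp_apply, hv] at h3

open Matrix in
theorem dotProduct_jacobianMatrix_mulVec {D : ℕ}
    (Φ : EuclideanSpace ℝ (Fin D) → EuclideanSpace ℝ (Fin D)) (x : EuclideanSpace ℝ (Fin D))
    (v : Fin D → ℝ) :
    v ⬝ᵥ (((jacobianMatrix Φ x)ᵀ * jacobianMatrix Φ x) *ᵥ v) =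
      ‖fderiv ℝ Φ x (WithLp.toLp 2 v)‖ ^ 2 := by
  have h : ∀ i, (jacobianMatrix Φ x *ᵥ v) i = fderiv ℝ Φ x (WithLp.toLp 2 v) i := by
    intro i
    have hv : WithLp.toLp 2 v = ∑ j, v j • EuclideanSpace.single j (1 : ℝ) := by
      ext k
      simp [Pi.single_apply]
    rw [hv, map_sum]
    simp [jacobianMatrix, mulVec, dotProduct, mul_comm]
  rw [← mulVec_mulVec, dotProduct_mulVec, vecMul_transpose, EuclideanSpace.real_norm_sq_eq]
  simp only [dotProduct, h, sq]

theorem IsBiLipschitz.isDistorted {D : ℕ} {ε : ℝ} (hε : 0 < ε)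
    {Φ : EuclideanSpace ℝ (Fin D) ≃ₘ[ℝ] EuclideanSpace ℝ (Fin D)}
    (h : IsBiLipschitz √(1 + ε) Φ) : IsDistorted ε Φ := by
  intro x
  have hherm : ((jacobianMatrix Φ x).transpose * jacobianMatrix Φ x).IsHermitian :=
    Matrix.isHermitian_conjTranspose_mul_self (jacobianMatrix Φ x)
  have hone : ∀ c : ℝ, (c • (1 : Matrix (Fin D) (Fin D) ℝ)).IsHermitian := fun c => by
    simp [Matrix.IsHermitian]
  have hsq : √(1 + ε) ^ 2 = 1 + ε := Real.sq_sqrt (by linarith)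
  have hv : ∀ v : Fin D → ℝ, v ⬝ᵥ v = ‖(WithLp.toLp 2 v : EuclideanSpace ℝ (Fin D))‖ ^ 2 := by
    intro v
    rw [EuclideanSpace.real_norm_sq_eq]
    simp [dotProduct, sq]
  constructor
  · refine .of_dotProduct_mulVec_nonneg (hherm.sub (hone _)) fun v => ?_
    have h1 := pow_le_pow_left₀ (norm_nonneg _)
      (h.norm_fderiv_apply (Real.sqrt_nonneg _) x (WithLp.toLp 2 v)).2 2
    rw [mul_pow, hsq] at h1
    rw [star_trivial, Matrix.sub_mulVec, dotProduct_sub, dotProduct_jacobianMatrix_mulVec,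
      Matrix.smul_mulVec, Matrix.one_mulVec, dotProduct_smul, hv, sub_nonneg, smul_eq_mul,
      inv_mul_le_iff₀ (by linarith)]
    exact h1
  · refine .of_dotProduct_mulVec_nonneg ((hone _).sub hherm) fun v => ?_
    have h1 := pow_le_pow_left₀ (norm_nonneg _)
      (h.norm_fderiv_apply (Real.sqrt_nonneg _) x (WithLp.toLp 2 v)).1 2
    rw [mul_pow, hsq] at h1
    rw [star_trivial, Matrix.sub_mulVec, dotProduct_sub, dotProduct_jacobianMatrix_mulVec,
      Matrix.smul_mulVec, Matrix.one_mulVec, dotProduct_smul, hv, sub_nonneg, smul_eq_mul]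
    exact h1

end Distortion

theorem theoreml (D : ℕ) :
    ∃ C : ℝ, 0 < C ∧ ∀ ε : ℝ, 0 < ε → ε < C →
      ∃ η δ : ℝ, 0 < η ∧ 0 < δ ∧
        ∀ (k : ℕ) (hk : 1 ≤ k), k ≤ D →
        ∀ y z : Fin k → EuclideanSpace ℝ (Fin D),
          y ⟨0, hk⟩ = z ⟨0, hk⟩ →
          (∀ i j : Fin k, i ≠ j →
            (1 + δ)⁻¹ ≤ ‖z i - z j‖ / ‖y i - y j‖ ∧
              ‖z i - z j‖ / ‖y i - y j‖ ≤ 1 + δ) →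
          ∃ Φ : EuclideanSpace ℝ (Fin D) ≃ₘ[ℝ] EuclideanSpace ℝ (Fin D),
            IsDistorted ε Φ ∧
            (∀ i : Fin k, Φ (y i) = z i) ∧
            (∀ x : EuclideanSpace ℝ (Fin D),
              η⁻¹ * Metric.diam (Set.range y) ≤ ‖x - y ⟨0, hk⟩‖ → Φ x = x) := by
  refine ⟨1, one_pos, fun ε hε _ => ?_⟩
  have hq : 1 < √(1 + ε) := by
    rw [Real.lt_sqrt zero_le_one]
    linarith
  obtain ⟨M, δ, hM, hδ, hext⟩ := exists_hasAlmostIsometricExtension_of_lt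
    (E := EuclideanSpace ℝ (Fin D)) hq D (by simp)
  refine ⟨M⁻¹, δ, inv_pos.2 hM, hδ, fun k hk hkD y z h0 hyz => ?_⟩
  obtain ⟨m, rfl⟩ : ∃ m, k = m + 1 := ⟨k - 1, by omega⟩
  -- Coinciding `y i` would make the quotient `0` by the convention on division, contradicting its
  -- positive lower bound.
  have hpos : ∀ i j, i ≠ j → 0 < ‖y i - y j‖ := by
    intro i j hij
    refine (norm_nonneg _).lt_of_ne fun h => ?_
    have h1 := (hyz i j hij).1
    rw [← h, div_zero] at h1
    exact (inv_pos.2 (by linarith : 0 < 1 + δ)).not_ge h1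
  obtain ⟨Φ, hΦ, hΦy, hΦf⟩ := hext m (by omega) y z
    (fun i j hij => by_contra fun hne => (hpos i j hne).ne' (by rw [hij, sub_self, norm_zero])) h0
    (fun i j => by
      by_cases hij : i = j
      · simp [hij]
      · obtain ⟨h1, h2⟩ := hyz i j hij
        have hy := hpos i j hij
        rw [le_div_iff₀ hy, inv_mul_le_iff₀ (by linarith)] at h1
        exact ⟨(div_le_iff₀ hy).1 h2, h1⟩)
    (Metric.diam (Set.range y))
    (fun i => by
      rw [← dist_eq_norm]
      exact Metric.dist_le_diam_of_mem (Set.finite_range y).isBounded ⟨i, rfl⟩ ⟨0, rfl⟩)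
  refine ⟨Φ, hΦ.isDistorted hε, hΦy, fun x hx => hΦf x ?_⟩
  rwa [inv_inv] at hx
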